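/- **Setting.** Fix integers $K\ge 1$, $0\le r<s$, quantile levels $\tau_1,\dots,\tau_K\in(0,1)$, weights $w_1,\dots,w_K>0$ and an index $k^*\in\{1,\dots,K\}$. Let $\rho_\tau(e)=(\tau-\mathbf 1\{e\le 0\})e$ and $L_{NT}=\min\{\sqrt N,\sqrt T\}$. All limits are joint limits $N,T\to\infty$. For each $N,T$ let $X_{it}$ ($i\le N$, $t\le T$) be real random variables (they may depend on $N,T$) with $$Q_{X_{it}}(\tau_k)=\lambda_{k,i}^{0\prime}f_t^0,\qquad k\le K,$$ where $Q_{X}(\tau)=\inf\{x:\tau\le P(X\le x)\}$ and the true loadings $\lambda^0_{k,i}\in\mathbb R^r$ and factors $f^0_t\in\mathbb R^r$ are non-random and may depend on $N,T$. Write $\Lambda_k^0=[\lambda^0_{k,1},\dots,\lambda^0_{k,N}]'$ and $F^0=[f^0_1,\dots,f^0_T]'$. For $\ell\in\{r,s\}$ let $\mathcal A^\ell,\mathcal F^\ell\subset\mathbb R^\ell$ be compact, and let $\Theta^\ell$ be the set of all $\theta=(\Lambda_1,\dots,\Lambda_K,F)$ with $\Lambda_k\in\mathbb R^{N\times\ell}$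 having rows $\lambda_{k,i}\in\mathcal A^\ell$ and $F\in\mathbb R^{T\times\ell}$ having rows $f_t\in\mathcal F^\ell$, such that $F'F/T=I_\ell$ and $\Lambda_{k^*}'\Lambda_{k^*}/N$ is diagonal with non-increasing diagonal entries. Let $$M_{NT}(\theta)=\frac1{NT}\sum_{k=1}^K\sum_{i=1}^N\sum_{t=1}^T w_k\,\rho_{\tau_k}\big(X_{it}-\lambda_{k,i}'f_t\big),$$ and let $\hat\theta^s=(\hat\Lambda^s_1,\dots,\hat\Lambda^s_K,\hat F^s)$ be a minimizer of $M_{NT}$ over $\Theta^s$. **Assumptions.** 1. For all large $N,T$: $\theta^0=(\Lambda_1^0,\dots,\Lambda_K^0,F^0)\in\Theta^r$; and, writing $\Lambda_{k^*}^{0\prime}\Lambda^0_{k^*}/N=\mathrm{diag}(\nu_1(N,T),\dots,\nu_r(N,T))$, one has $\nu_j(N,T)\to\nu_j$ for all $j$, where $\nu_1>\dots>\nu_r>0$. 2. $X_{it}$ has a density $h_{it}$, and for every compact $C\subset\mathbb R$ there are constants $0<c\le c'<\infty$ with $c\le h_{it}(x)\le c'$ for all $x\in C$ and all $i,t,N,T$.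 3. For each $k$ (and each $N,T$) the errors $\epsilon_{k,it}=X_{it}-\lambda^{0\prime}_{k,i}f^0_t$ are independent across all $(i,t)$. 4. For all large $N,T$ there is $V\in\mathbb R^{T\times(s-r)}$ such that $F^*=[F^0\;V]$ satisfies $F^{*\prime}F^*/T=I_s$, the rows of $F^*$ lie in $\mathcal F^s$, and the rows of $\Lambda_k^*=[\Lambda_k^0\;\mathbf 0]$ lie in $\mathcal A^s$ for every $k$. **Theorem.** Let $\kappa_{NT}$ be real numbers with $\kappa_{NT}\to0$ and $\kappa_{NT}L_{NT}\to\infty$ as $N,T\to\infty$. Let $\hat\sigma^k_1(N)\ge\dots\ge\hat\sigma^k_s(N)$ be the eigenvalues of $\hat\Lambda_k^{s\prime}\hat\Lambda_k^s/N$ and set $$\hat r=\max_{1\le k\le K}\ \sum_{i=1}^s\mathbf 1\{\hat\sigma^k_i(N)>\kappa_{NT}\}.$$ Then $P(\hat r=r)\to1$ as $N,T\to\infty$. (If $\hat\theta^s$ is not chosen measurably, $P$ denotes outer probability, and moreover $P(\hat r\ne r)\to0$.) -/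

import Mathlib

open MeasureTheory ProbabilityTheory Filter Topology
open scoped Matrix

noncomputable section

namespace DAFM

/-- A parameter `θ` of the `ℓ`-factor model with `K` quantile levels, `N` units and `T` periods:
`Λ k` is the `N × ℓ` matrix whose rows are the loadings `λ_{k,i}`, and `F` is the `T × ℓ` matrix
whose rows are the factors `f_t`. -/
structure Param (K N T ℓ : ℕ) where
  Λ : Fin K → Matrix (Fin N) (Fin ℓ) ℝ
  F : Matrix (Fin T) (Fin ℓ) ℝ

/-- The common component `λ_{k,i}' f_t`. -/
def Param.common {K N T ℓ : ℕ} (θ : Param K N T ℓ) (k : Fin K) (i : Fin N) (t : Fin T) : ℝ :=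
  θ.Λ k i ⬝ᵥ θ.F t

/-- The normalized Gram matrix `A'A / n` of an `n × ℓ` matrix `A`. -/
def gram {n ℓ : ℕ} (A : Matrix (Fin n) (Fin ℓ) ℝ) : Matrix (Fin ℓ) (Fin ℓ) ℝ :=
  (n : ℝ)⁻¹ • (Aᵀ * A)

theorem gram_isHermitian {n ℓ : ℕ} (A : Matrix (Fin n) (Fin ℓ) ℝ) : (gram A).IsHermitian := by
  ext i j
  simp [gram, Matrix.mul_apply, mul_comm]

/-- The check function `ρ_τ(e) = (τ - 1{e ≤ 0}) e`. -/
def check (τ e : ℝ) : ℝ := (τ - if e ≤ 0 then 1 else 0) * e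

/-- The objective function
`M_{NT}(θ) = (NT)⁻¹ ∑_k ∑_i ∑_t w_k ρ_{τ_k}(x_{it} - λ_{k,i}' f_t)` at the data matrix `x`. -/
def objective {K N T ℓ : ℕ} (τ w : Fin K → ℝ) (x : Fin N → Fin T → ℝ) (θ : Param K N T ℓ) : ℝ :=
  ((N : ℝ) * (T : ℝ))⁻¹ *
    ∑ k : Fin K, ∑ i : Fin N, ∑ t : Fin T, w k * check (τ k) (x i t - θ.common k i t)

/-- The parameter space: loadings in `𝒜`, factors in `ℱ`, `F'F / T` is the identity matrix, and
`Λ_{k*}' Λ_{k*} / N` is diagonal with non-increasing diagonal entries. -/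
structure Param.Admissible {K N T ℓ : ℕ} (kstar : Fin K) (𝒜 ℱ : Set (Fin ℓ → ℝ))
    (θ : Param K N T ℓ) : Prop where
  loading_mem : ∀ k i, θ.Λ k i ∈ 𝒜
  factor_mem : ∀ t, θ.F t ∈ ℱ
  factor_normalized : gram θ.F = 1
  loading_diag : (gram (θ.Λ kstar)).IsDiag
  loading_sorted : ∀ i j : Fin ℓ, i ≤ j → gram (θ.Λ kstar) j j ≤ gram (θ.Λ kstar) i i

/-- `θ` minimizes the objective function over the parameter space. -/
def IsEstimate {K N T ℓ : ℕ} (τ w : Fin K → ℝ) (kstar : Fin K) (𝒜 ℱ : Set (Fin ℓ → ℝ))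
    (x : Fin N → Fin T → ℝ) (θ : Param K N T ℓ) : Prop :=
  θ.Admissible kstar 𝒜 ℱ ∧
    ∀ θ' : Param K N T ℓ, θ'.Admissible kstar 𝒜 ℱ → objective τ w x θ ≤ objective τ w x θ'

/-- The `τ`-quantile `inf {x : τ ≤ P(Y ≤ x)}` of a real random variable `Y`. -/
def quantile {Ω : Type*} [MeasurableSpace Ω] (P : Measure Ω) (Y : Ω → ℝ) (τ : ℝ) : ℝ :=
  sInf {x : ℝ | τ ≤ P.real {ω | Y ω ≤ x}}

/-- The block matrix `[A  V]`. -/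
def appendCols {n r ℓ : ℕ} (A : Matrix (Fin n) (Fin r) ℝ) (V : Matrix (Fin n) (Fin (ℓ - r)) ℝ) :
    Matrix (Fin n) (Fin ℓ) ℝ :=
  Matrix.of fun i j =>
    if h : j.val < r then A i ⟨j.val, h⟩ else V i ⟨j.val - r, by have := j.isLt; omega⟩

/-- `L_{NT} = min {√N, √T}`. -/
def rate (N T : ℕ) : ℝ := min (Real.sqrt N) (Real.sqrt T)

/-- The eigenvalues `σ_1 ≥ ⋯ ≥ σ_ℓ` of `A'A / n`, with multiplicity. -/
def gramEigenvalue {n ℓ : ℕ} (A : Matrix (Fin n) (Fin ℓ) ℝ) (i : Fin ℓ) : ℝ :=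
  (gram_isHermitian A).eigenvalues₀ (Fin.cast (Fintype.card_fin ℓ).symm i)

/-- The rank-based number of factors of `θ` with threshold `κ`: the maximum over `k` of the number
of eigenvalues of `Λ_k' Λ_k / N` that exceed `κ`. -/
def rankEstimate {K N T ℓ : ℕ} (κ : ℝ) (θ : Param K N T ℓ) : ℕ :=
  Finset.univ.sup fun k : Fin K => ∑ i : Fin ℓ, if κ < gramEigenvalue (θ.Λ k) i then 1 else 0

/-- The data-adaptive `r`-factor model. For each sample size `(N, T)` the data `X N T i t` are
random variables whose `τ_k`-quantile is the true common component `λ⁰_{k,i}' f⁰_t`; the true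
loadings and factors `θ₀ N T` are non-random (fixed effects). -/
structure QuantileFactorModel {Ω : Type*} [MeasurableSpace Ω] (P : Measure Ω) {K r : ℕ}
    (τ : Fin K → ℝ) (θ₀ : ∀ N T : ℕ, Param K N T r)
    (X : ∀ N T : ℕ, Fin N → Fin T → Ω → ℝ) : Prop where
  measurable : ∀ N T i t, Measurable (X N T i t)
  quantile_eq : ∀ N T k i t, quantile P (X N T i t) (τ k) = (θ₀ N T).common k i t

/-- Assumptions for consistency. Here `h N T i t` is the density of `X N T i t`, and `(N, T)`
tends to infinity jointly; the normalization of the true parameter is only possible for `T ≥ r`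
and hence is required for all large `(N, T)`. -/
structure ConsistencyAssumptions {Ω : Type*} [MeasurableSpace Ω] (P : Measure Ω) {K r : ℕ}
    (kstar : Fin K) (𝒜 ℱ : Set (Fin r → ℝ)) (θ₀ : ∀ N T : ℕ, Param K N T r)
    (X : ∀ N T : ℕ, Fin N → Fin T → Ω → ℝ) (h : ∀ N T : ℕ, Fin N → Fin T → ℝ → ℝ) : Prop where
  isCompact_loadings : IsCompact 𝒜
  isCompact_factors : IsCompact ℱ
  admissible : ∀ᶠ p : ℕ × ℕ in atTop ×ˢ atTop, (θ₀ p.1 p.2).Admissible kstar 𝒜 ℱ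
  eigenvalue_limits : ∃ ν : Fin r → ℝ, StrictAnti ν ∧ (∀ j, 0 < ν j) ∧
    ∀ j, Tendsto (fun p : ℕ × ℕ => gram ((θ₀ p.1 p.2).Λ kstar) j j) (atTop ×ˢ atTop) (𝓝 (ν j))
  density_measurable : ∀ N T i t, Measurable (h N T i t)
  density : ∀ N T i t,
    P.map (X N T i t) = (volume : Measure ℝ).withDensity fun x => ENNReal.ofReal (h N T i t x)
  density_lower : ∀ C : Set ℝ, IsCompact C →
    ∃ c : ℝ, 0 < c ∧ ∀ N T i t, ∀ x ∈ C, c ≤ h N T i t x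
  errors_indep : ∀ N T k, iIndepFun
    (fun (p : Fin N × Fin T) (ω : Ω) => X N T p.1 p.2 ω - (θ₀ N T).common k p.1 p.2) P

/-- Further assumptions for estimating the number of factors by fitting `ℓ` factors: the densities
are locally bounded above, uniformly, and the parameter space with `ℓ` factors contains the true
parameter, with zero loadings on suitable additional factors `V`. -/
structure FactorNumberAssumptions {K r ℓ : ℕ} (𝒜 ℱ : Set (Fin ℓ → ℝ))
    (θ₀ : ∀ N T : ℕ, Param K N T r) (h : ∀ N T : ℕ, Fin N → Fin T → ℝ → ℝ) : Prop where
  density_upper : ∀ C : Set ℝ, IsCompact C →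
    ∃ c : ℝ, 0 < c ∧ ∀ N T i t, ∀ x ∈ C, h N T i t x ≤ c
  augmented_mem : ∀ᶠ p : ℕ × ℕ in atTop ×ˢ atTop,
    ∃ V : Matrix (Fin p.2) (Fin (ℓ - r)) ℝ,
      gram (appendCols (ℓ := ℓ) (θ₀ p.1 p.2).F V) = 1 ∧
      (∀ k i, appendCols (ℓ := ℓ) ((θ₀ p.1 p.2).Λ k) 0 i ∈ 𝒜) ∧
      ∀ t, appendCols (ℓ := ℓ) (θ₀ p.1 p.2).F V t ∈ ℱ

end DAFM

end

noncomputable section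

namespace DAFM

/-! Only the common components have to be estimated well; separate convergence of loadings and
factors is never needed. Let `D` be the sum over `k, i, t` of the squared differences between fitted
and true common components.

Padding the true parameter with zero loadings gives a competitor in the `s`-factor space with the
true common components, so the estimate has loss at most the true one. For a fixed bounded candidate
the expected excess loss is at least a constant times `D` (`integral_check_sub_ge`), while its
fluctuation is sub-Gaussian with variance proxy also of order `D`. Hence a candidate competes with
probability at most `exp (-b D)` (`prob_loss_sub_le`). A union bound over a grid of mesh of order `1
/ min N T` (`prob_exists_far_le`) costs order `(N + T) log (min N T)` in the exponent. This is
negligible against `κ N T` because `κ L_{NT} → ∞` (`grid_card_mul_exp_le`). So `D ≤ κ N T` outside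
an event of probability at most `exp (-N)`.

The rest is deterministic linear algebra. Since `F'F / T = 1`, the bound `D ≤ κ N T` allows at most
`r` eigenvalues above `κ` for every `k` (`card_gramEigenvalue_le`). At `k*`, where the true loadings
are well conditioned, it forces at least `r` of them once `4 κ < ν` (`le_card_gramEigenvalue`). -/

/-! ### Quantiles of variables with a density. -/

theorem continuous_cdf_of_singleton_null {μ : Measure ℝ} [IsProbabilityMeasure μ]
    (hμ : ∀ a : ℝ, μ {a} = 0) : Continuous (cdf μ) := by
  rw [continuous_iff_continuousAt]
  intro a
  -- The jump of the distribution function at `a` is the mass of `{a}`.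
  rw [(cdf μ).mono.continuousAt_iff_leftLim_eq_rightLim, (cdf μ).rightLim_eq]
  refine le_antisymm ((cdf μ).mono.leftLim_le le_rfl) ?_
  have h1 := (cdf μ).measure_singleton a
  rw [measure_cdf, hμ a, eq_comm, ENNReal.ofReal_eq_zero] at h1
  linarith

theorem cdf_sInf_eq {μ : Measure ℝ} [IsProbabilityMeasure μ] (hμ : ∀ a : ℝ, μ {a} = 0)
    {τ : ℝ} (h0 : 0 < τ) (h1 : τ < 1) : cdf μ (sInf {x : ℝ | τ ≤ cdf μ x}) = τ := by
  have hc := continuous_cdf_of_singleton_null hμ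
  obtain ⟨a, ha⟩ := ((tendsto_cdf_atBot μ).eventually (gt_mem_nhds h0)).exists
  obtain ⟨b, hb⟩ := ((tendsto_cdf_atTop μ).eventually (lt_mem_nhds h1)).exists
  obtain ⟨x₀, hx₀⟩ := mem_range_of_exists_le_of_exists_ge hc ⟨a, ha.le⟩ ⟨b, hb.le⟩
  have hbdd : BddBelow {x : ℝ | τ ≤ cdf μ x} :=
    ⟨a, fun x hx => le_of_lt ((cdf μ).mono.reflect_lt (lt_of_lt_of_le ha hx))⟩
  have hmem : x₀ ∈ {x : ℝ | τ ≤ cdf μ x} := hx₀.ge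
  refine le_antisymm ?_ ?_
  · rw [← hx₀]
    exact (cdf μ).mono (hx₀ ▸ csInf_le hbdd hmem)
  · exact (isClosed_le continuous_const hc).csInf_mem ⟨x₀, hmem⟩ hbdd

/-- A random variable with a density is at most its `τ`-quantile with probability `τ`. -/
theorem prob_le_quantile {Ω : Type*} [MeasurableSpace Ω] {P : Measure Ω} [IsProbabilityMeasure P]
    {Y : Ω → ℝ} (hY : Measurable Y) {f : ℝ → ℝ}
    (hf : P.map Y = (volume : Measure ℝ).withDensity fun x => ENNReal.ofReal (f x))
    {τ : ℝ} (h0 : 0 < τ) (h1 : τ < 1) : P.real {ω | Y ω ≤ quantile P Y τ} = τ := by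
  have := Measure.isProbabilityMeasure_map (μ := P) hY.aemeasurable
  have hcdf : ∀ x, P.real {ω | Y ω ≤ x} = cdf (P.map Y) x := fun x => by
    rw [cdf_eq_real, map_measureReal_apply hY measurableSet_Iic]
    rfl
  have hnull : ∀ a : ℝ, P.map Y {a} = 0 := fun a => by
    rw [hf]
    exact withDensity_absolutelyContinuous _ _ (measure_singleton a)
  rw [hcdf, quantile]
  simp_rw [hcdf]
  exact cdf_sInf_eq hnull h0 h1

theorem prob_mem_Ioc_ge {Ω : Type*} [MeasurableSpace Ω] {P : Measure Ω} [IsProbabilityMeasure P]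
    {Y : Ω → ℝ} (hY : Measurable Y) {f : ℝ → ℝ}
    (hf : P.map Y = (volume : Measure ℝ).withDensity fun x => ENNReal.ofReal (f x))
    {a b c : ℝ} (hab : a ≤ b) (hc : ∀ x ∈ Set.Ioc a b, c ≤ f x) :
    c * (b - a) ≤ P.real {ω | Y ω ∈ Set.Ioc a b} := by
  rcases le_or_gt c 0 with h | h
  · exact (mul_nonpos_of_nonpos_of_nonneg h (by linarith)).trans measureReal_nonneg
  have h1 : ENNReal.ofReal c * volume (Set.Ioc a b) ≤ P.map Y (Set.Ioc a b) := by
    rw [hf, withDensity_apply _ measurableSet_Ioc, ← setLIntegral_const]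
    exact setLIntegral_mono' measurableSet_Ioc fun x hx => ENNReal.ofReal_le_ofReal (hc x hx)
  rw [Real.volume_Ioc, ← ENNReal.ofReal_mul h.le, Measure.map_apply hY measurableSet_Ioc] at h1
  rw [Measure.real]
  exact (ENNReal.ofReal_le_iff_le_toReal (measure_ne_top _ _)).1 h1

/-! ### The check loss and its quadratic identification. -/

theorem measurable_check (τ : ℝ) : Measurable (check τ) := by
  unfold check
  refine Measurable.mul (Measurable.sub measurable_const ?_) measurable_id
  exact Measurable.ite measurableSet_Iic measurable_const measurable_const

theorem abs_check_sub_check_le {τ : ℝ} (h0 : 0 ≤ τ) (h1 : τ ≤ 1) (a b : ℝ) :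
    |check τ a - check τ b| ≤ |a - b| := by
  unfold check
  rw [abs_le]
  constructor <;> split_ifs <;> cases abs_cases (a - b) <;> nlinarith

/-- A pointwise lower bound of the check function: its tangent plus a local gain. -/
theorem check_sub_ge (τ y q u : ℝ) :
    (-u) * (τ - Set.indicator (Set.Iic q) 1 y) +
        |u| / 2 * Set.indicator (Set.Ioc (min q (q + u / 2)) (max q (q + u / 2))) 1 y ≤
      check τ (y - (q + u)) - check τ (y - q) := by
  -- For `y` between `q` and `q + u`, the exact gain over the tangent is the distance from `y` to `q
  -- + u`; on the half next to `q` it is at least `|u| / 2`.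
  unfold check
  rcases le_total 0 u with h | h
  · rw [abs_of_nonneg h, min_eq_left (by linarith), max_eq_right (by linarith)]
    simp only [Set.indicator_apply, Set.mem_Iic, Set.mem_Ioc, Pi.one_apply]
    split_ifs <;> simp_all <;> nlinarith
  · rw [abs_of_nonpos h, min_eq_right (by linarith), max_eq_left (by linarith)]
    simp only [Set.indicator_apply, Set.mem_Iic, Set.mem_Ioc, Pi.one_apply]
    split_ifs <;> simp_all <;> nlinarith

/-- Quadratic identification: the expected check loss at `c` exceeds that at the quantile. -/
theorem integral_check_sub_ge {Ω : Type*} [MeasurableSpace Ω] {P : Measure Ω}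
    [IsProbabilityMeasure P] {Y : Ω → ℝ} (hY : Measurable Y) {f : ℝ → ℝ}
    (hf : P.map Y = (volume : Measure ℝ).withDensity fun x => ENNReal.ofReal (f x))
    {τ : ℝ} (h0 : 0 < τ) (h1 : τ < 1) {B a q c : ℝ} (hq : quantile P Y τ = q)
    (hqB : |q| ≤ B) (hcB : |c| ≤ B) (hfB : ∀ x ∈ Set.Icc (-B) B, a ≤ f x) :
    a / 4 * (c - q) ^ 2 ≤ ∫ ω, (check τ (Y ω - c) - check τ (Y ω - q)) ∂P := by
  set u := c - q with hu
  set l := min q (q + u / 2)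
  set m := max q (q + u / 2)
  have hml : m - l = |u| / 2 := by
    simp only [m, l, max_sub_min_eq_abs, add_sub_cancel_left, abs_div, abs_two]
  rw [abs_le] at hqB hcB
  have hp1 : P.real (Y ⁻¹' Set.Iic q) = τ := by
    rw [← hq]
    exact prob_le_quantile hY hf h0 h1
  have hp2 : a * (|u| / 2) ≤ P.real (Y ⁻¹' Set.Ioc l m) := by
    rw [← hml]
    refine prob_mem_Ioc_ge hY hf min_le_max fun x hx => hfB x ⟨?_, ?_⟩
    · refine le_trans (le_min hqB.1 ?_) hx.1.le
      linarith
    · refine hx.2.trans (max_le hqB.2 ?_)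
      linarith
  have i1 : Integrable (fun ω => (Y ⁻¹' Set.Iic q).indicator (1 : Ω → ℝ) ω) P :=
    (integrable_const (1 : ℝ)).indicator (hY measurableSet_Iic)
  have i2 : Integrable (fun ω => (Y ⁻¹' Set.Ioc l m).indicator (1 : Ω → ℝ) ω) P :=
    (integrable_const (1 : ℝ)).indicator (hY measurableSet_Ioc)
  have i3 : Integrable (fun ω => check τ (Y ω - c) - check τ (Y ω - q)) P := by
    refine Integrable.of_bound (C := |q - c|) ?_ (Eventually.of_forall fun ω => ?_)
    · exact (((measurable_check τ).comp (hY.sub_const c)).sub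
        ((measurable_check τ).comp (hY.sub_const q))).aestronglyMeasurable
    · rw [Real.norm_eq_abs]
      refine (abs_check_sub_check_le h0.le h1.le _ _).trans (le_of_eq ?_)
      congr 1
      ring
  -- The tangent term has mean zero because `P(Y ≤ q) = τ`; the local gain `|u| / 2` occurs with
  -- probability at least `a |u| / 2`.
  calc a / 4 * u ^ 2 = (|u| / 2) * (a * (|u| / 2)) := by rw [← sq_abs]; ring
    _ ≤ (|u| / 2) * P.real (Y ⁻¹' Set.Ioc l m) := by gcongr
    _ = (-u) * (τ - P.real (Y ⁻¹' Set.Iic q)) + (|u| / 2) * P.real (Y ⁻¹' Set.Ioc l m) := by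
        rw [hp1]; ring
    _ = ∫ ω, ((-u) * (τ - (Y ⁻¹' Set.Iic q).indicator (1 : Ω → ℝ) ω) +
          |u| / 2 * (Y ⁻¹' Set.Ioc l m).indicator (1 : Ω → ℝ) ω) ∂P := by
        have i4 : Integrable (fun ω => -u * (τ - (Y ⁻¹' Set.Iic q).indicator (1 : Ω → ℝ) ω)) P :=
          ((integrable_const τ).sub i1).const_mul _
        rw [integral_add i4 (i2.const_mul _),
          integral_const_mul, integral_const_mul, integral_sub (integrable_const τ) i1,
          integral_indicator_one (hY measurableSet_Iic),
          integral_indicator_one (hY measurableSet_Ioc)]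
        simp
    _ ≤ _ := by
        refine integral_mono (((((integrable_const τ).sub i1)).const_mul _).add (i2.const_mul _))
          i3 fun ω => ?_
        have := check_sub_ge τ (Y ω) q u
        rw [show q + u = c by rw [hu]; ring] at this
        exact this

/-! ### Deviation inequality for a fixed candidate. -/

/-- Exponential bound for the probability that a fixed candidate `c` nearly beats the vector of
true quantiles `q` in terms of the weighted check loss. -/
theorem prob_loss_sub_le {Ω : Type*} [MeasurableSpace Ω] {P : Measure Ω} [IsProbabilityMeasure P]
    {ι κ : Type*} [Fintype ι] [Fintype κ] {Y : ι → Ω → ℝ} (hY : ∀ p, Measurable (Y p))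
    (hind : iIndepFun Y P) {f : ι → ℝ → ℝ}
    (hf : ∀ p, P.map (Y p) = (volume : Measure ℝ).withDensity fun x => ENNReal.ofReal (f p x))
    {τ w : κ → ℝ} (hτ : ∀ k, 0 < τ k ∧ τ k < 1) {w₀ W a B : ℝ} (hw₀ : 0 < w₀)
    (hw : ∀ k, w₀ ≤ w k) (hW : ∑ k, w k ^ 2 ≤ W) (ha : 0 < a)
    {q c : κ → ι → ℝ} (hq : ∀ k p, quantile P (Y p) (τ k) = q k p)
    (hqB : ∀ k p, |q k p| ≤ B) (hcB : ∀ k p, |c k p| ≤ B)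
    (hfB : ∀ p, ∀ x ∈ Set.Icc (-B) B, a ≤ f p x) :
    P.real {ω | ∑ p, ∑ k, w k * (check (τ k) (Y p ω - c k p) - check (τ k) (Y p ω - q k p)) ≤
        w₀ * a / 8 * ∑ p, ∑ k, (c k p - q k p) ^ 2} ≤
      Real.exp (-((w₀ * a / 8) ^ 2 / (2 * W) * ∑ p, ∑ k, (c k p - q k p) ^ 2)) := by
  -- The losses at different levels `k` share the same observation, so they are summed first;
  -- independence is used only across `p`.
  set g : ι → ℝ → ℝ := fun p y =>
    ∑ k, w k * (check (τ k) (y - c k p) - check (τ k) (y - q k p)) with hg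
  have hgm : ∀ p, Measurable (g p) := fun p => by
    refine Finset.measurable_sum _ fun k _ => Measurable.const_mul ?_ _
    exact ((measurable_check _).comp (measurable_id.sub_const _)).sub
      ((measurable_check _).comp (measurable_id.sub_const _))
  set D : ι → ℝ := fun p => ∑ k, (c k p - q k p) ^ 2 with hD
  have hD0 : ∀ p, 0 ≤ D p := fun p => Finset.sum_nonneg fun k _ => sq_nonneg _
  set Z : ι → ℝ := fun p => ∑ k, w k * |c k p - q k p| with hZ
  have hwk : ∀ k, 0 ≤ w k := fun k => hw₀.le.trans (hw k)
  have hgZ : ∀ p y, |g p y| ≤ Z p := fun p y => by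
    refine (Finset.abs_sum_le_sum_abs _ _).trans (Finset.sum_le_sum fun k _ => ?_)
    rw [abs_mul, abs_of_nonneg (hwk k)]
    refine mul_le_mul_of_nonneg_left ?_ (hwk k)
    refine (abs_check_sub_check_le (hτ k).1.le (hτ k).2.le _ _).trans (le_of_eq ?_)
    rw [abs_sub_comm (c k p)]
    congr 1
    ring
  have hZ0 : ∀ p, 0 ≤ Z p := fun p =>
    Finset.sum_nonneg fun k _ => mul_nonneg (hwk k) (abs_nonneg _)
  -- Cauchy–Schwarz bounds the variance proxy by the same `D` that drives the mean, which makes the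
  -- final exponent linear in `D`.
  have hZD : ∀ p, Z p ^ 2 ≤ W * D p := fun p => by
    refine (Finset.sum_mul_sq_le_sq_mul_sq _ _ _).trans ?_
    simp only [sq_abs]
    exact mul_le_mul_of_nonneg_right hW (hD0 p)
  have hint : ∀ p k, Integrable
      (fun ω => check (τ k) (Y p ω - c k p) - check (τ k) (Y p ω - q k p)) P := fun p k => by
    refine Integrable.of_bound (C := |q k p - c k p|) ?_ (Eventually.of_forall fun ω => ?_)
    · exact (((measurable_check _).comp ((hY p).sub_const _)).sub
        ((measurable_check _).comp ((hY p).sub_const _))).aestronglyMeasurable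
    · rw [Real.norm_eq_abs]
      refine (abs_check_sub_check_le (hτ k).1.le (hτ k).2.le _ _).trans (le_of_eq ?_)
      congr 1
      ring
  have hmean : ∀ p, w₀ * a / 4 * D p ≤ ∫ ω, g p (Y p ω) ∂P := fun p => by
    simp only [hg]
    rw [integral_finsetSum _ fun k _ => (hint p k).const_mul _, Finset.mul_sum]
    refine Finset.sum_le_sum fun k _ => ?_
    rw [integral_const_mul]
    have h1 := integral_check_sub_ge (hY p) (hf p) (hτ k).1 (hτ k).2 (hq k p) (hqB k p) (hcB k p)
      (hfB p)
    calc w₀ * a / 4 * (c k p - q k p) ^ 2 = w₀ * (a / 4 * (c k p - q k p) ^ 2) := by ring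
      _ ≤ w k * (a / 4 * (c k p - q k p) ^ 2) := by
          have := hw k
          gcongr
      _ ≤ _ := mul_le_mul_of_nonneg_left h1 (hwk k)
  -- Hoeffding's lemma on `[-Z p, Z p]`: the parameter is `Z p ^ 2`.
  have hsub : ∀ p ∈ Finset.univ, HasSubgaussianMGF
      (fun ω => (fun y => -(y - ∫ ω, g p (Y p ω) ∂P)) (g p (Y p ω)))
      ((‖Z p - -Z p‖₊ / 2) ^ 2) P := fun p _ => by
    have h1 := hasSubgaussianMGF_of_mem_Icc (μ := P) (X := fun ω => g p (Y p ω))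
      ((hgm p).comp (hY p)).aemeasurable
      (Eventually.of_forall fun ω => abs_le.1 (hgZ p (Y p ω)))
    exact h1.neg
  have hind' : iIndepFun (fun p ω => (fun y => -(y - ∫ ω, g p (Y p ω) ∂P)) (g p (Y p ω))) P :=
    hind.comp (fun p y => -(g p y - ∫ ω, g p (Y p ω) ∂P)) fun p => ((hgm p).sub_const _).neg
  have hSD : 0 ≤ ∑ p, D p := Finset.sum_nonneg fun p _ => hD0 p
  -- The deviation is half of the drift `w₀ * a / 4 * ∑ D`.
  have hkey := HasSubgaussianMGF.measure_sum_ge_le_of_iIndepFun hind' hsub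
    (ε := w₀ * a / 8 * ∑ p, D p) (by positivity)
  have hvar : ((∑ p, (‖Z p - -Z p‖₊ / 2) ^ 2 : NNReal) : ℝ) ≤ W * ∑ p, D p := by
    push_cast
    rw [Finset.mul_sum]
    refine Finset.sum_le_sum fun p _ => ?_
    refine le_trans (le_of_eq ?_) (hZD p)
    rw [Real.norm_eq_abs, div_pow, sq_abs]
    ring
  refine (measureReal_mono ?_).trans (hkey.trans (Real.exp_le_exp.2 ?_))
  · intro ω hω
    simp only [Set.mem_ofPred_eq] at hω ⊢
    rw [Finset.sum_neg_distrib, Finset.sum_sub_distrib]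
    have h1 : w₀ * a / 4 * ∑ p, D p ≤ ∑ p, ∫ ω, g p (Y p ω) ∂P := by
      rw [Finset.mul_sum]
      exact Finset.sum_le_sum fun p _ => hmean p
    have h2 : ∑ p, g p (Y p ω) ≤ w₀ * a / 8 * ∑ p, D p := hω
    linarith
  · rw [neg_div, neg_le_neg_iff]
    set V : ℝ := ((∑ p, (‖Z p - -Z p‖₊ / 2) ^ 2 : NNReal) : ℝ) with hV
    have hV0 : 0 ≤ V := NNReal.coe_nonneg _
    rcases hSD.eq_or_lt with h | h
    · rw [← h]; simp
    -- Division by `V = 0` would return `0` and void the bound; but `V = 0` forces every `D p` to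
    -- vanish.
    rcases hV0.eq_or_lt with h' | h'
    · exfalso
      have hZz : ∀ p, Z p = 0 := by
        intro p
        have h3 : (∑ p, (‖Z p - -Z p‖₊ / 2) ^ 2 : NNReal) = 0 := by
          exact NNReal.coe_eq_zero.1 h'.symm
        rw [Finset.sum_eq_zero_iff] at h3
        have h4 := h3 p (Finset.mem_univ _)
        simp only [pow_eq_zero_iff two_ne_zero, div_eq_zero_iff, nnnorm_eq_zero] at h4
        rcases h4 with h4 | h4
        · linarith
        · norm_num at h4
      have hDz : ∀ p, D p = 0 := by
        intro p
        refine Finset.sum_eq_zero fun k _ => ?_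
        have h5 := hZz p
        simp only [hZ] at h5
        rw [Finset.sum_eq_zero_iff_of_nonneg
          (fun k _ => mul_nonneg (hwk k) (abs_nonneg _))] at h5
        have h6 := h5 k (Finset.mem_univ _)
        rcases mul_eq_zero.1 h6 with h6 | h6
        · have := hw k; linarith
        · rw [abs_eq_zero.1 h6]; ring
      rw [Finset.sum_eq_zero fun p _ => hDz p] at h
      exact lt_irrefl _ h
    · rw [le_div_iff₀ (by positivity)]
      have hW0 : 0 < W := by
        by_contra hW0
        nlinarith [not_lt.1 hW0]
      calc (w₀ * a / 8) ^ 2 / (2 * W) * (∑ p, D p) * (2 * V)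
          ≤ (w₀ * a / 8) ^ 2 / (2 * W) * (∑ p, D p) * (2 * (W * ∑ p, D p)) := by gcongr
        _ = _ := by field_simp

/-! ### Counting eigenvalues of Gram matrices. -/

/-- The count ignores the order, so the sorted eigenvalues can be replaced by those indexed by the
eigenvector basis. -/
theorem sum_indicator_gramEigenvalue {n ℓ : ℕ} (A : Matrix (Fin n) (Fin ℓ) ℝ) (κ : ℝ) :
    (∑ i : Fin ℓ, if κ < gramEigenvalue A i then 1 else 0) =
      (Finset.univ.filter fun j => κ < (gram_isHermitian A).eigenvalues j).card := by
  rw [Finset.card_filter]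
  set e : Fin ℓ ≃ Fin ℓ := (finCongr (Fintype.card_fin ℓ).symm).trans
    (Fintype.equivOfCardEq (Fintype.card_fin (Fintype.card (Fin ℓ)))) with he
  rw [← Equiv.sum_comp e fun j => if κ < (gram_isHermitian A).eigenvalues j then 1 else 0]
  refine Finset.sum_congr rfl fun i _ => ?_
  rw [Matrix.IsHermitian.eigenvalues, gramEigenvalue, he]
  simp

theorem dotProduct_eq_sum_eigenvectorBasis {ℓ : ℕ} {G : Matrix (Fin ℓ) (Fin ℓ) ℝ}
    (hG : G.IsHermitian) (w : Fin ℓ → ℝ) :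
    w ⬝ᵥ w = ∑ j, ((hG.eigenvectorBasis j).ofLp ⬝ᵥ w) ^ 2 := by
  have := hG.eigenvectorBasis.sum_inner_mul_inner (WithLp.toLp 2 w) (WithLp.toLp 2 w)
  simp only [EuclideanSpace.inner_eq_star_dotProduct, star_trivial] at this
  rw [← this]
  refine Finset.sum_congr rfl fun j _ => ?_
  rw [dotProduct_comm w, sq]

theorem dotProduct_mulVec_eq_sum_eigenvectorBasis {ℓ : ℕ} {G : Matrix (Fin ℓ) (Fin ℓ) ℝ}
    (hG : G.IsHermitian) (w : Fin ℓ → ℝ) :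
    w ⬝ᵥ (G *ᵥ w) = ∑ j, hG.eigenvalues j * ((hG.eigenvectorBasis j).ofLp ⬝ᵥ w) ^ 2 := by
  have := hG.eigenvectorBasis.sum_inner_mul_inner (WithLp.toLp 2 w) (WithLp.toLp 2 (G *ᵥ w))
  simp only [EuclideanSpace.inner_eq_star_dotProduct, star_trivial] at this
  rw [dotProduct_comm, ← this]
  refine Finset.sum_congr rfl fun j _ => ?_
  have h1 : (G *ᵥ w) ⬝ᵥ (hG.eigenvectorBasis j).ofLp =
      hG.eigenvalues j * ((hG.eigenvectorBasis j).ofLp ⬝ᵥ w) := by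
    have h2 := hG.mulVec_eigenvectorBasis j
    have hT : Gᵀ = G := by simpa only [Matrix.conjTranspose_eq_transpose_of_trivial] using hG.eq
    rw [dotProduct_comm, Matrix.dotProduct_mulVec, ← Matrix.mulVec_transpose, hT, h2,
      smul_dotProduct, smul_eq_mul]
  rw [h1]
  ring

theorem mulVec_dotProduct_mulVec {n ℓ : ℕ} (A : Matrix (Fin n) (Fin ℓ) ℝ) (w : Fin ℓ → ℝ) :
    (A *ᵥ w) ⬝ᵥ (A *ᵥ w) = n * (w ⬝ᵥ (gram A *ᵥ w)) := by
  rcases Nat.eq_zero_or_pos n with rfl | hn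
  · simp [dotProduct]
  have : (n : ℝ) ≠ 0 := by positivity
  rw [gram, Matrix.smul_mulVec, dotProduct_smul, smul_eq_mul, mul_inv_cancel_left₀ this,
    ← Matrix.mulVec_mulVec, Matrix.dotProduct_mulVec w, Matrix.vecMul_transpose]

theorem mulVec_dotProduct_mulVec_of_gram_eq_one {n ℓ : ℕ} {A : Matrix (Fin n) (Fin ℓ) ℝ}
    (hA : gram A = 1) (w : Fin ℓ → ℝ) : (A *ᵥ w) ⬝ᵥ (A *ᵥ w) = n * (w ⬝ᵥ w) := by
  rw [mulVec_dotProduct_mulVec, hA, Matrix.one_mulVec]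

theorem transpose_mulVec_mulVec_of_gram_eq_one {n ℓ : ℕ} {A : Matrix (Fin n) (Fin ℓ) ℝ}
    (hA : gram A = 1) (w : Fin ℓ → ℝ) : Aᵀ *ᵥ (A *ᵥ w) = (n : ℝ) • w := by
  rcases Nat.eq_zero_or_pos n with rfl | hn
  · ext i
    simp [Matrix.mulVec, dotProduct]
  have : (n : ℝ) ≠ 0 := by positivity
  rw [Matrix.mulVec_mulVec]
  have h1 : Aᵀ * A = (n : ℝ) • gram A := by rw [gram, smul_inv_smul₀ this]
  rw [h1, hA, Matrix.smul_mulVec, Matrix.one_mulVec]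

/-- The Frobenius norm dominates the operator norm, by Cauchy–Schwarz in each row. -/
theorem mulVec_dotProduct_self_le {n m : ℕ} (D : Matrix (Fin n) (Fin m) ℝ) (u : Fin m → ℝ) :
    (D *ᵥ u) ⬝ᵥ (D *ᵥ u) ≤ (∑ i, ∑ t, D i t ^ 2) * (u ⬝ᵥ u) := by
  rw [dotProduct, Finset.sum_mul]
  refine Finset.sum_le_sum fun i _ => ?_
  have := Finset.sum_mul_sq_le_sq_mul_sq Finset.univ (D i) u
  simp only [Matrix.mulVec, dotProduct]
  simpa only [sq] using this

theorem dotProduct_self_pos {m : ℕ} {v : Fin m → ℝ} (hv : v ≠ 0) : 0 < v ⬝ᵥ v := by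
  have h0 : 0 ≤ v ⬝ᵥ v := Finset.sum_nonneg fun i _ => mul_self_nonneg _
  refine h0.lt_of_ne fun h => hv ?_
  exact dotProduct_self_eq_zero.1 h.symm

/-- A product `ΛF'` with `F'F / T = 1` that is close to a product of inner dimension `r` has at
most `r` large eigenvalues. -/
theorem card_gramEigenvalue_le {N T r s : ℕ} (hN : 0 < N) (hT : 0 < T)
    {L : Matrix (Fin N) (Fin s) ℝ} {F : Matrix (Fin T) (Fin s) ℝ} (hF : gram F = 1)
    (L₀ : Matrix (Fin N) (Fin r) ℝ) (F₀ : Matrix (Fin T) (Fin r) ℝ) {κ : ℝ}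
    (hD : ∑ i, ∑ t, (L i ⬝ᵥ F t - L₀ i ⬝ᵥ F₀ t) ^ 2 ≤ κ * (N * T)) :
    (∑ i : Fin s, if κ < gramEigenvalue L i then 1 else 0) ≤ r := by
  rw [sum_indicator_gramEigenvalue]
  set hG := gram_isHermitian L
  set S := Finset.univ.filter fun j => κ < hG.eigenvalues j with hS
  by_contra! hlt
  -- If `r < |S|`, the target has dimension `(s - |S|) + r < s`. A kernel vector `w` lies in the
  -- span of the large eigenvectors, and `F w` is annihilated by `F₀ᵀ`.
  let φ : (Fin s → ℝ) →ₗ[ℝ] ({j // j ∉ S} → ℝ) × (Fin r → ℝ) :=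
    (LinearMap.pi fun j => dotProductBilin ℝ ℝ (hG.eigenvectorBasis j.1).ofLp).prod
      (F₀ᵀ * F).mulVecLin
  have hker : LinearMap.ker φ ≠ ⊥ := by
    apply LinearMap.ker_ne_bot_of_finrank_lt
    have h1 : Fintype.card {j // j ∉ S} = s - S.card := by
      rw [Fintype.card_subtype_compl]; simp
    have h2 : S.card ≤ s := by simpa using Finset.card_le_univ S
    simp only [Module.finrank_prod, Module.finrank_fintype_fun_eq_card, h1, Fintype.card_fin]
    omega
  obtain ⟨w, hw, hw0⟩ := Submodule.exists_mem_ne_zero_of_ne_bot hker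
  have hw1 : ∀ j ∉ S, (hG.eigenvectorBasis j).ofLp ⬝ᵥ w = 0 := fun j hj =>
    congrFun (congrArg Prod.fst (LinearMap.mem_ker.1 hw)) ⟨j, hj⟩
  have hw2 : F₀ᵀ *ᵥ (F *ᵥ w) = 0 := by
    rw [Matrix.mulVec_mulVec]
    exact congrArg Prod.snd (LinearMap.mem_ker.1 hw)
  have hpos := dotProduct_self_pos hw0
  have hquad : κ * (w ⬝ᵥ w) < w ⬝ᵥ (gram L *ᵥ w) := by
    rw [dotProduct_mulVec_eq_sum_eigenvectorBasis hG, dotProduct_eq_sum_eigenvectorBasis hG,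
      Finset.mul_sum]
    have hle : ∀ j, κ * ((hG.eigenvectorBasis j).ofLp ⬝ᵥ w) ^ 2 ≤
        hG.eigenvalues j * ((hG.eigenvectorBasis j).ofLp ⬝ᵥ w) ^ 2 := fun j => by
      by_cases hj : j ∈ S
      · exact mul_le_mul_of_nonneg_right (by simpa [hS] using (Finset.mem_filter.1 hj).2.le)
          (sq_nonneg _)
      · rw [hw1 j hj]; simp
    refine Finset.sum_lt_sum (fun j _ => hle j) ?_
    by_contra! hcon
    rw [dotProduct_eq_sum_eigenvectorBasis hG] at hpos
    refine hpos.ne' (Finset.sum_eq_zero fun j _ => ?_)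
    by_cases hj : j ∈ S
    · have h1 := hcon j (Finset.mem_univ _)
      have h2 : κ < hG.eigenvalues j := (Finset.mem_filter.1 hj).2
      nlinarith [sq_nonneg ((hG.eigenvectorBasis j).ofLp ⬝ᵥ w)]
    · rw [hw1 j hj]; simp
  -- On `F w` the difference of the products acts as `L Fᵀ` alone. Its squared norm exceeds `κ N T²
  -- |w|²` by `hquad`, yet the Frobenius bound caps it by the same quantity.
  have hLw : (L * Fᵀ - L₀ * F₀ᵀ) *ᵥ (F *ᵥ w) = (T : ℝ) • (L *ᵥ w) := by
    rw [Matrix.sub_mulVec, ← Matrix.mulVec_mulVec, ← Matrix.mulVec_mulVec, hw2,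
      transpose_mulVec_mulVec_of_gram_eq_one hF, Matrix.mulVec_zero, sub_zero, Matrix.mulVec_smul]
  have h1 := mulVec_dotProduct_self_le (L * Fᵀ - L₀ * F₀ᵀ) (F *ᵥ w)
  rw [hLw, smul_dotProduct, dotProduct_smul, mulVec_dotProduct_mulVec,
    mulVec_dotProduct_mulVec_of_gram_eq_one hF] at h1
  have h2 : ∑ i, ∑ t, (L * Fᵀ - L₀ * F₀ᵀ) i t ^ 2 ≤ κ * (N * T) := hD
  have hT' : (0 : ℝ) < T := by positivity
  have hN' : (0 : ℝ) < N := by positivity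
  have h3 : (T : ℝ) • (T : ℝ) • ((N : ℝ) * w ⬝ᵥ (gram L *ᵥ w)) ≤
      κ * (N * T) * (T * (w ⬝ᵥ w)) :=
    h1.trans (mul_le_mul_of_nonneg_right h2 (by positivity))
  simp only [smul_eq_mul] at h3
  have h4 : (T * T * N : ℝ) * (κ * (w ⬝ᵥ w)) < (T * T * N : ℝ) * (w ⬝ᵥ (gram L *ᵥ w)) := by
    gcongr
  nlinarith

/-- A product `ΛF'` that is close to a product `Λ₀F₀'` whose loadings are well conditioned has at
least `r` large eigenvalues. -/
theorem le_card_gramEigenvalue {N T r s : ℕ} (hN : 0 < N) (hT : 0 < T)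
    {L : Matrix (Fin N) (Fin s) ℝ} {F : Matrix (Fin T) (Fin s) ℝ} (hF : gram F = 1)
    {L₀ : Matrix (Fin N) (Fin r) ℝ} {F₀ : Matrix (Fin T) (Fin r) ℝ} (hF₀ : gram F₀ = 1)
    {κ ν : ℝ} (hκ : 0 ≤ κ) (hν : ∀ v : Fin r → ℝ, ν * (v ⬝ᵥ v) ≤ v ⬝ᵥ (gram L₀ *ᵥ v))
    (hκν : 4 * κ < ν) (hD : ∑ i, ∑ t, (L i ⬝ᵥ F t - L₀ i ⬝ᵥ F₀ t) ^ 2 ≤ κ * (N * T)) :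
    r ≤ ∑ i : Fin s, if κ < gramEigenvalue L i then 1 else 0 := by
  rw [sum_indicator_gramEigenvalue]
  set hG := gram_isHermitian L
  set S := Finset.univ.filter fun j => κ < hG.eigenvalues j with hS
  by_contra! hlt
  have hT' : (0 : ℝ) < T := by positivity
  have hN' : (0 : ℝ) < N := by positivity
  -- If `|S| < r`, some `v ≠ 0` has `y = Fᵀ F₀ v` orthogonal to all large eigenvectors, so `L y` is
  -- small.
  let φ : (Fin r → ℝ) →ₗ[ℝ] ({j // j ∈ S} → ℝ) :=
    (LinearMap.pi fun j => dotProductBilin ℝ ℝ (hG.eigenvectorBasis j.1).ofLp) ∘ₗ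
      (Fᵀ * F₀).mulVecLin
  have hker : LinearMap.ker φ ≠ ⊥ := by
    apply LinearMap.ker_ne_bot_of_finrank_lt
    simpa only [Module.finrank_fintype_fun_eq_card, Fintype.card_coe, Fintype.card_fin] using hlt
  obtain ⟨v, hv, hv0⟩ := Submodule.exists_mem_ne_zero_of_ne_bot hker
  set y := Fᵀ *ᵥ (F₀ *ᵥ v) with hy
  have hy1 : ∀ j ∈ S, (hG.eigenvectorBasis j).ofLp ⬝ᵥ y = 0 := fun j hj => by
    rw [hy, Matrix.mulVec_mulVec]
    exact congrFun (LinearMap.mem_ker.1 hv) ⟨j, hj⟩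
  have hpos := dotProduct_self_pos hv0
  have hquad : y ⬝ᵥ (gram L *ᵥ y) ≤ κ * (y ⬝ᵥ y) := by
    rw [dotProduct_mulVec_eq_sum_eigenvectorBasis hG, dotProduct_eq_sum_eigenvectorBasis hG,
      Finset.mul_sum]
    refine Finset.sum_le_sum fun j _ => ?_
    by_cases hj : j ∈ S
    · rw [hy1 j hj]; simp
    · have h1 : hG.eigenvalues j ≤ κ := by simpa [hS] using hj
      exact mul_le_mul_of_nonneg_right h1 (sq_nonneg _)
  -- Bessel's inequality for the orthonormal columns of `F / √T`.
  have hbessel : y ⬝ᵥ y ≤ T ^ 2 * (v ⬝ᵥ v) := by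
    have h1 : 0 ≤ ((T : ℝ) • (F₀ *ᵥ v) - F *ᵥ y) ⬝ᵥ ((T : ℝ) • (F₀ *ᵥ v) - F *ᵥ y) :=
      Finset.sum_nonneg fun i _ => mul_self_nonneg _
    have h2 : (F *ᵥ y) ⬝ᵥ (F₀ *ᵥ v) = y ⬝ᵥ y := by
      rw [hy, ← Matrix.vecMul_transpose, ← Matrix.dotProduct_mulVec]
    rw [sub_dotProduct, dotProduct_sub, dotProduct_sub, smul_dotProduct, smul_dotProduct,
      dotProduct_smul, dotProduct_smul, dotProduct_comm (F₀ *ᵥ v) (F *ᵥ y), h2,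
      mulVec_dotProduct_mulVec_of_gram_eq_one hF,
      mulVec_dotProduct_mulVec_of_gram_eq_one hF₀] at h1
    simp only [smul_eq_mul] at h1
    have h3 : (0 : ℝ) ≤ T * (T ^ 2 * (v ⬝ᵥ v) - y ⬝ᵥ y) := by nlinarith
    have h4 := nonneg_of_mul_nonneg_right h3 hT'
    linarith
  set x₁ := L *ᵥ y with hx₁
  set x₂ := (L * Fᵀ - L₀ * F₀ᵀ) *ᵥ (F₀ *ᵥ v) with hx₂
  -- Both `x₁` and `x₂` have squared norm at most `κ N T² |v|²`; the square of a difference costs a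
  -- further factor 2 on each, whence `4 κ < ν`.
  have hx : (T : ℝ) • (L₀ *ᵥ v) = x₁ - x₂ := by
    rw [hx₁, hx₂, Matrix.sub_mulVec, ← Matrix.mulVec_mulVec, ← Matrix.mulVec_mulVec,
      transpose_mulVec_mulVec_of_gram_eq_one hF₀, Matrix.mulVec_smul, hy]
    abel
  have h1 : x₁ ⬝ᵥ x₁ ≤ N * (κ * (T ^ 2 * (v ⬝ᵥ v))) := by
    rw [hx₁, mulVec_dotProduct_mulVec]
    gcongr
    exact hquad.trans (mul_le_mul_of_nonneg_left hbessel hκ)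
  have h2 : x₂ ⬝ᵥ x₂ ≤ κ * (N * T) * (T * (v ⬝ᵥ v)) := by
    refine (mulVec_dotProduct_self_le _ _).trans ?_
    rw [mulVec_dotProduct_mulVec_of_gram_eq_one hF₀]
    exact mul_le_mul_of_nonneg_right hD (by positivity)
  have h3 : (x₁ - x₂) ⬝ᵥ (x₁ - x₂) ≤ 2 * (x₁ ⬝ᵥ x₁) + 2 * (x₂ ⬝ᵥ x₂) := by
    simp only [dotProduct, Finset.mul_sum, ← Finset.sum_add_distrib]
    refine Finset.sum_le_sum fun i _ => ?_
    simp only [Pi.sub_apply]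
    nlinarith [sq_nonneg (x₁ i + x₂ i)]
  rw [← hx, smul_dotProduct, dotProduct_smul, mulVec_dotProduct_mulVec] at h3
  simp only [smul_eq_mul] at h3
  have h4 : (T * (T * (N * (ν * (v ⬝ᵥ v)))) : ℝ) ≤ T * (T * (N * (v ⬝ᵥ (gram L₀ *ᵥ v)))) := by
    have := hν v
    gcongr
  have h5 : (T * T * N * (v ⬝ᵥ v) : ℝ) * (4 * κ) < (T * T * N * (v ⬝ᵥ v) : ℝ) * ν := by
    gcongr
  nlinarith

/-! ### Discretization and the union bound. -/

/-- The cost of rounding to the grid: `check τ` is 1-Lipschitz. -/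
theorem loss_le_of_close {ι κ : Type*} [Fintype ι] [Fintype κ] {τ w : κ → ℝ}
    (hτ : ∀ k, 0 < τ k ∧ τ k < 1) (hw : ∀ k, 0 ≤ w k) {c c' q : κ → ι → ℝ} (y : ι → ℝ) {δ : ℝ}
    (hδ : ∀ k p, |c k p - c' k p| ≤ δ) :
    ∑ p, ∑ k, w k * (check (τ k) (y p - c' k p) - check (τ k) (y p - q k p)) ≤
      ∑ p, ∑ k, w k * (check (τ k) (y p - c k p) - check (τ k) (y p - q k p)) +
        Fintype.card ι * ((∑ k, w k) * δ) := by
  have : (Fintype.card ι * ((∑ k, w k) * δ) : ℝ) = ∑ _p : ι, ∑ k, w k * δ := by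
    simp [Finset.sum_mul]
  rw [this, ← Finset.sum_add_distrib]
  refine Finset.sum_le_sum fun p _ => ?_
  rw [← Finset.sum_add_distrib]
  refine Finset.sum_le_sum fun k _ => ?_
  rw [← mul_add]
  refine mul_le_mul_of_nonneg_left ?_ (hw k)
  have h1 := (le_abs_self _).trans
    (abs_check_sub_check_le (hτ k).1.le (hτ k).2.le (y p - c' k p) (y p - c k p))
  rw [show y p - c' k p - (y p - c k p) = c k p - c' k p by ring] at h1
  linarith [hδ k p]

theorem sum_sq_sub_le_of_close {ι κ : Type*} [Fintype ι] [Fintype κ] {c c' q : κ → ι → ℝ}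
    {δ B : ℝ} (hδ0 : 0 ≤ δ) (hδ : ∀ k p, |c k p - c' k p| ≤ δ) (hc : ∀ k p, |c k p| ≤ B)
    (hc' : ∀ k p, |c' k p| ≤ B) (hq : ∀ k p, |q k p| ≤ B) :
    ∑ p, ∑ k, (c k p - q k p) ^ 2 ≤ ∑ p, ∑ k, (c' k p - q k p) ^ 2 +
      Fintype.card ι * (Fintype.card κ * (δ * (4 * B))) := by
  have : (Fintype.card ι * (Fintype.card κ * (δ * (4 * B))) : ℝ) =
      ∑ _p : ι, ∑ _k : κ, δ * (4 * B) := by simp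
  rw [this, ← Finset.sum_add_distrib]
  refine Finset.sum_le_sum fun p _ => ?_
  rw [← Finset.sum_add_distrib]
  refine Finset.sum_le_sum fun k _ => ?_
  have h1 : (c k p - c' k p) * (c k p + c' k p - 2 * q k p) ≤ δ * (4 * B) := by
    refine (le_abs_self _).trans ?_
    rw [abs_mul]
    refine mul_le_mul (hδ k p) ?_ (abs_nonneg _) hδ0
    have h2 := abs_le.1 (hc k p)
    have h3 := abs_le.1 (hc' k p)
    have h4 := abs_le.1 (hq k p)
    exact abs_le.2 ⟨by linarith [h2.1, h3.1, h4.2], by linarith [h2.2, h3.2, h4.1]⟩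
  nlinarith

/-- The `j`-th of `m + 1` equidistant points of `[-B, B]`. -/
def gridPoint (B : ℝ) (m : ℕ) (j : Fin (m + 1)) : ℝ := -B + 2 * B * (j / m)

theorem abs_gridPoint_le {B : ℝ} (hB : 0 ≤ B) (m : ℕ) (j : Fin (m + 1)) :
    |gridPoint B m j| ≤ B := by
  have h0 : (0 : ℝ) ≤ (j : ℝ) / m := by positivity
  have h1 : (j : ℝ) / m ≤ 1 := by
    refine div_le_one_of_le₀ ?_ (Nat.cast_nonneg _)
    exact_mod_cast Nat.le_of_lt_succ j.isLt
  rw [abs_le, gridPoint]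
  constructor <;> nlinarith

theorem exists_gridPoint_close {B : ℝ} (hB : 0 < B) {m : ℕ} (hm : 0 < m) {x : ℝ} (hx : |x| ≤ B) :
    ∃ j : Fin (m + 1), |x - gridPoint B m j| ≤ 2 * B / m := by
  have hx' := abs_le.1 hx
  have hm' : (0 : ℝ) < m := by positivity
  set y : ℝ := (x + B) * m / (2 * B) with hy
  have hy0 : 0 ≤ y := by
    have : 0 ≤ x + B := by linarith
    positivity
  have hym : y ≤ m := by
    rw [hy, div_le_iff₀ (by positivity)]
    nlinarith
  have hfl : ⌊y⌋₊ < m + 1 := Nat.lt_succ_of_le ((Nat.floor_le_floor hym).trans (by simp))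
  refine ⟨⟨⌊y⌋₊, hfl⟩, ?_⟩
  have h1 : x - gridPoint B m ⟨⌊y⌋₊, hfl⟩ = 2 * B / m * (y - ⌊y⌋₊) := by
    have h0 : x + B = 2 * B / m * y := by
      rw [hy]
      field_simp
    simp only [gridPoint]
    linear_combination h0
  have h2 := Nat.floor_le hy0
  have h3 := Nat.lt_floor_add_one y
  rw [h1, abs_of_nonneg (mul_nonneg (by positivity) (by linarith))]
  have : (0 : ℝ) ≤ 2 * B / m := by positivity
  nlinarith

/-- All entries of the parameter are bounded by `B` in absolute value. -/
def Param.BoundedBy {K N T ℓ : ℕ} (θ : Param K N T ℓ) (B : ℝ) : Prop :=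
  (∀ k i j, |θ.Λ k i j| ≤ B) ∧ ∀ t j, |θ.F t j| ≤ B

theorem Param.BoundedBy.abs_common_le {K N T ℓ : ℕ} {θ : Param K N T ℓ} {B : ℝ}
    (hθ : θ.BoundedBy B) (k : Fin K) (i : Fin N) (t : Fin T) :
    |θ.common k i t| ≤ ℓ * B ^ 2 := by
  rw [Param.common, dotProduct]
  refine (Finset.abs_sum_le_sum_abs _ _).trans ?_
  refine (Finset.sum_le_card_nsmul _ _ (B ^ 2) fun j _ => ?_).trans (by simp)
  rw [abs_mul, sq]
  exact mul_le_mul (hθ.1 k i j) (hθ.2 t j) (abs_nonneg _) ((abs_nonneg _).trans (hθ.1 k i j))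

/-- Indices of the parameters whose entries are grid points. -/
abbrev GridIndex (K N T ℓ m : ℕ) : Type :=
  (Fin K → Fin N → Fin ℓ → Fin (m + 1)) × (Fin T → Fin ℓ → Fin (m + 1))

/-- The parameter whose entries are the grid points with the given indices. -/
def gridParam {K N T ℓ m : ℕ} (B : ℝ) (g : GridIndex K N T ℓ m) : Param K N T ℓ where
  Λ k := Matrix.of fun i j => gridPoint B m (g.1 k i j)
  F := Matrix.of fun t j => gridPoint B m (g.2 t j)

theorem gridParam_boundedBy {K N T ℓ m : ℕ} {B : ℝ} (hB : 0 ≤ B) (g : GridIndex K N T ℓ m) :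
    (gridParam B g).BoundedBy B :=
  ⟨fun _ _ _ => abs_gridPoint_le hB _ _, fun _ _ => abs_gridPoint_le hB _ _⟩

theorem card_gridIndex (K N T ℓ m : ℕ) :
    Fintype.card (GridIndex K N T ℓ m) = (m + 1) ^ (K * (N * ℓ) + T * ℓ) := by
  simp only [Fintype.card_prod, Fintype.card_fun, Fintype.card_fin, ← pow_mul, ← pow_add]
  congr 1
  ring

theorem exists_gridParam_close {K N T ℓ m : ℕ} {B : ℝ} (hB : 0 < B) (hm : 0 < m)
    {θ : Param K N T ℓ} (hθ : θ.BoundedBy B) :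
    ∃ g : GridIndex K N T ℓ m, ∀ k i t,
      |θ.common k i t - (gridParam B g).common k i t| ≤ ℓ * (4 * B ^ 2 / m) := by
  choose a ha using fun k i j => exists_gridPoint_close hB hm (hθ.1 k i j)
  choose b hb using fun t j => exists_gridPoint_close hB hm (hθ.2 t j)
  refine ⟨(a, b), fun k i t => ?_⟩
  rw [Param.common, Param.common, dotProduct, dotProduct, ← Finset.sum_sub_distrib]
  refine (Finset.abs_sum_le_sum_abs _ _).trans ?_
  refine (Finset.sum_le_card_nsmul _ _ (4 * B ^ 2 / m) fun j _ => ?_).trans (by simp)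
  change |θ.Λ k i j * θ.F t j - gridPoint B m (a k i j) * gridPoint B m (b t j)| ≤ _
  have h1 : θ.Λ k i j * θ.F t j - gridPoint B m (a k i j) * gridPoint B m (b t j) =
      (θ.Λ k i j - gridPoint B m (a k i j)) * θ.F t j +
        gridPoint B m (a k i j) * (θ.F t j - gridPoint B m (b t j)) := by ring
  rw [h1]
  refine (abs_add_le _ _).trans ?_
  rw [abs_mul, abs_mul]
  have h2 := mul_le_mul (ha k i j) (hθ.2 t j) (abs_nonneg _) (by positivity)
  have h3 := mul_le_mul (abs_gridPoint_le hB.le m (a k i j)) (hb t j) (abs_nonneg _) hB.le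
  refine (add_le_add h2 h3).trans (le_of_eq ?_)
  ring

/-- Exponential bound for the probability that some bounded parameter far from the true common
components does not have a larger loss than those. -/
theorem prob_exists_far_le {Ω : Type*} [MeasurableSpace Ω] {P : Measure Ω} [IsProbabilityMeasure P]
    {K N T s m : ℕ} (hm : 0 < m)
    {Y : Fin N × Fin T → Ω → ℝ} (hY : ∀ p, Measurable (Y p))
    (hind : iIndepFun Y P) {f : Fin N × Fin T → ℝ → ℝ}
    (hf : ∀ p, P.map (Y p) = (volume : Measure ℝ).withDensity fun x => ENNReal.ofReal (f p x))
    {τ w : Fin K → ℝ} (hτ : ∀ k, 0 < τ k ∧ τ k < 1) {w₀ W a B η : ℝ} (hw₀ : 0 < w₀)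
    (hw : ∀ k, w₀ ≤ w k) (hW : ∑ k, w k ^ 2 ≤ W) (ha : 0 < a) (hB : 0 < B)
    {q : Fin K → Fin N × Fin T → ℝ} (hq : ∀ k p, quantile P (Y p) (τ k) = q k p)
    (hqB : ∀ k p, |q k p| ≤ s * B ^ 2)
    (hfB : ∀ p, ∀ x ∈ Set.Icc (-(s * B ^ 2)) (s * B ^ 2), a ≤ f p x)
    (hη₁ : K * (s * (4 * B ^ 2 / m) * (4 * (s * B ^ 2))) ≤ η / 2)
    (hη₂ : (∑ k, w k) * (s * (4 * B ^ 2 / m)) ≤ w₀ * a / 8 * (η / 2)) :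
    P {ω | ∃ θ : Param K N T s, θ.BoundedBy B ∧
        ∑ p, ∑ k, w k * (check (τ k) (Y p ω - θ.common k p.1 p.2) -
          check (τ k) (Y p ω - q k p)) ≤ 0 ∧
        η * (N * T) < ∑ p : Fin N × Fin T, ∑ k, (θ.common k p.1 p.2 - q k p) ^ 2} ≤
      ENNReal.ofReal ((m + 1 : ℝ) ^ (K * (N * s) + T * s) *
        Real.exp (-((w₀ * a / 8) ^ 2 / (2 * W) * (η / 2 * (N * T))))) := by
  set D : GridIndex K N T s m → ℝ := fun g =>
    ∑ p : Fin N × Fin T, ∑ k, ((gridParam B g).common k p.1 p.2 - q k p) ^ 2 with hD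
  -- Grid parameters need not satisfy the normalizations; the deviation bound asks only for
  -- boundedness. Rounding may use up half of `η`, hence `η / 2`, and the slack `w₀ * a / 8 * D g`
  -- absorbs the change in loss.
  set E : GridIndex K N T s m → Set Ω := fun g =>
    {ω | η / 2 * (N * T) ≤ D g ∧ ∑ p : Fin N × Fin T, ∑ k, w k *
      (check (τ k) (Y p ω - (gridParam B g).common k p.1 p.2) - check (τ k) (Y p ω - q k p)) ≤
        w₀ * a / 8 * D g} with hE
  set β : ℝ := Real.exp (-((w₀ * a / 8) ^ 2 / (2 * W) * (η / 2 * (N * T)))) with hβ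
  have hW0 : 0 ≤ W := (Finset.sum_nonneg fun k _ => sq_nonneg _).trans hW
  have hEβ : ∀ g, P (E g) ≤ ENNReal.ofReal β := fun g => by
    by_cases hg : η / 2 * (N * T) ≤ D g
    · rw [← ofReal_measureReal]
      refine ENNReal.ofReal_le_ofReal ?_
      refine (measureReal_mono fun ω hω => hω.2).trans ((prob_loss_sub_le hY hind hf hτ hw₀ hw hW
        ha hq hqB (c := fun k p => (gridParam B g).common k p.1 p.2)
        (fun k p => (gridParam_boundedBy hB.le g).abs_common_le k p.1 p.2) hfB).trans ?_)
      rw [hβ, Real.exp_le_exp, neg_le_neg_iff]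
      gcongr
    · have : E g = ∅ := Set.eq_empty_of_forall_notMem fun ω hω => hg hω.1
      rw [this, measure_empty]
      exact zero_le
  have hsub : {ω | ∃ θ : Param K N T s, θ.BoundedBy B ∧
        ∑ p, ∑ k, w k * (check (τ k) (Y p ω - θ.common k p.1 p.2) -
          check (τ k) (Y p ω - q k p)) ≤ 0 ∧
        η * (N * T) < ∑ p : Fin N × Fin T, ∑ k, (θ.common k p.1 p.2 - q k p) ^ 2} ⊆
      ⋃ g, E g := by
    rintro ω ⟨θ, hθB, hθ, hfar⟩
    obtain ⟨g, hg⟩ := exists_gridParam_close hB hm hθB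
    have hgB := gridParam_boundedBy hB.le g
    have hδ : ∀ k (p : Fin N × Fin T),
        |θ.common k p.1 p.2 - (gridParam B g).common k p.1 p.2| ≤ s * (4 * B ^ 2 / m) :=
      fun k p => hg k p.1 p.2
    have hcard : (Fintype.card (Fin N × Fin T) : ℝ) = N * T := by simp
    have hNT : (0 : ℝ) ≤ N * T := by positivity
    have h1 := loss_le_of_close (q := q) hτ (fun k => hw₀.le.trans (hw k)) (fun p => Y p ω) hδ
    have h2 := sum_sq_sub_le_of_close (by positivity) hδ
      (fun k p => hθB.abs_common_le k p.1 p.2) (fun k p => hgB.abs_common_le k p.1 p.2) hqB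
    rw [hcard, Fintype.card_fin] at h2
    rw [hcard] at h1
    have h3 := mul_le_mul_of_nonneg_left hη₁ hNT
    have h4 := mul_le_mul_of_nonneg_left hη₂ hNT
    have h5 : η / 2 * (N * T) ≤ D g := by
      have : ∑ p : Fin N × Fin T, ∑ k, (θ.common k p.1 p.2 - q k p) ^ 2 ≤
        D g + N * T * (K * (s * (4 * B ^ 2 / m) * (4 * (s * B ^ 2)))) := h2
      linarith
    refine Set.mem_iUnion.2 ⟨g, h5, ?_⟩
    have h6 : w₀ * a / 8 * (η / 2 * (N * T)) ≤ w₀ * a / 8 * D g := by gcongr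
    linarith
  calc P _ ≤ P (⋃ g, E g) := measure_mono hsub
    _ ≤ ∑ g, P (E g) := measure_iUnion_fintype_le _ _
    _ ≤ ∑ _g : GridIndex K N T s m, ENNReal.ofReal β := Finset.sum_le_sum fun g _ => hEβ g
    _ = _ := by
      rw [Finset.sum_const, Finset.card_univ, card_gridIndex, nsmul_eq_mul,
        ENNReal.ofReal_mul (by positivity)]
      congr 1
      rw [← ENNReal.ofReal_natCast]
      push_cast
      rfl

/-! ### The augmented true parameter as a competitor. -/

theorem sum_appendCols_zero {n r ℓ : ℕ} (hrℓ : r ≤ ℓ) (A : Matrix (Fin n) (Fin r) ℝ) (i : Fin n)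
    (v : Fin ℓ → ℝ) :
    appendCols (ℓ := ℓ) A 0 i ⬝ᵥ v = ∑ j : Fin r, A i j * v (Fin.castLE hrℓ j) := by
  obtain ⟨m, rfl⟩ := Nat.exists_eq_add_of_le hrℓ
  rw [dotProduct, Fin.sum_univ_add]
  simp only [appendCols, Matrix.of_apply, Fin.val_castAdd, Fin.is_lt, dite_true, Fin.eta,
    Fin.val_natAdd, add_lt_iff_neg_left, not_lt_zero, dite_false, Matrix.zero_apply, zero_mul,
    Finset.sum_const_zero, add_zero]
  rfl

theorem appendCols_zero_dotProduct {n m r ℓ : ℕ} (hrℓ : r ≤ ℓ) (A : Matrix (Fin n) (Fin r) ℝ)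
    (F : Matrix (Fin m) (Fin r) ℝ) (V : Matrix (Fin m) (Fin (ℓ - r)) ℝ) (i : Fin n) (t : Fin m) :
    appendCols (ℓ := ℓ) A 0 i ⬝ᵥ appendCols F V t = A i ⬝ᵥ F t := by
  rw [sum_appendCols_zero hrℓ, dotProduct]
  refine Finset.sum_congr rfl fun j _ => ?_
  simp [appendCols]

theorem gram_appendCols_zero_of_lt {n r ℓ : ℕ} (A : Matrix (Fin n) (Fin r) ℝ) {i j : Fin ℓ}
    (hi : i.val < r) (hj : j.val < r) :
    gram (appendCols (ℓ := ℓ) A 0) i j = gram A ⟨i, hi⟩ ⟨j, hj⟩ := by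
  simp [gram, Matrix.mul_apply, appendCols, hi, hj]

theorem gram_appendCols_zero_of_le_left {n r ℓ : ℕ} (A : Matrix (Fin n) (Fin r) ℝ) {i : Fin ℓ}
    (hi : r ≤ i.val) (j : Fin ℓ) : gram (appendCols (ℓ := ℓ) A 0) i j = 0 := by
  simp [gram, Matrix.mul_apply, appendCols, hi.not_gt]

theorem gram_appendCols_zero_of_le_right {n r ℓ : ℕ} (A : Matrix (Fin n) (Fin r) ℝ) (i : Fin ℓ)
    {j : Fin ℓ} (hj : r ≤ j.val) : gram (appendCols (ℓ := ℓ) A 0) i j = 0 := by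
  simp [gram, Matrix.mul_apply, appendCols, hj.not_gt]

theorem gram_diag_nonneg {n ℓ : ℕ} (A : Matrix (Fin n) (Fin ℓ) ℝ) (i : Fin ℓ) :
    0 ≤ gram A i i := by
  rw [gram, Matrix.smul_apply, Matrix.mul_apply, smul_eq_mul]
  exact mul_nonneg (by positivity) (Finset.sum_nonneg fun j _ => mul_self_nonneg _)

/-- The parameter with additional factors `V` that carry zero loadings. -/
def Param.augment {K N T r ℓ : ℕ} (θ : Param K N T r) (V : Matrix (Fin T) (Fin (ℓ - r)) ℝ) :
    Param K N T ℓ where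
  Λ k := appendCols (θ.Λ k) 0
  F := appendCols θ.F V

theorem Param.augment_common {K N T r ℓ : ℕ} (hrℓ : r ≤ ℓ) (θ : Param K N T r)
    (V : Matrix (Fin T) (Fin (ℓ - r)) ℝ) (k : Fin K) (i : Fin N) (t : Fin T) :
    (θ.augment V).common k i t = θ.common k i t :=
  appendCols_zero_dotProduct hrℓ _ _ _ _ _

/-- Zero columns border the Gram matrix of the loadings by zeros. It stays diagonal, and it stays
sorted because Gram diagonals are non-negative. -/
theorem Param.Admissible.augment {K N T r ℓ : ℕ} {kstar : Fin K}
    {𝒜 ℱ : Set (Fin r → ℝ)} {𝒜' ℱ' : Set (Fin ℓ → ℝ)} {θ : Param K N T r}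
    (hθ : θ.Admissible kstar 𝒜 ℱ) {V : Matrix (Fin T) (Fin (ℓ - r)) ℝ}
    (h1 : gram (appendCols (ℓ := ℓ) θ.F V) = 1)
    (h2 : ∀ k i, appendCols (ℓ := ℓ) (θ.Λ k) 0 i ∈ 𝒜')
    (h3 : ∀ t, appendCols (ℓ := ℓ) θ.F V t ∈ ℱ') :
    (θ.augment V).Admissible kstar 𝒜' ℱ' where
  loading_mem := h2
  factor_mem := h3
  factor_normalized := h1
  loading_diag := by
    intro i j hij
    change gram (appendCols (θ.Λ kstar) 0) i j = 0
    rcases lt_or_ge i.val r with hi | hi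
    · rcases lt_or_ge j.val r with hj | hj
      · rw [gram_appendCols_zero_of_lt _ hi hj]
        exact hθ.loading_diag fun h => hij (Fin.ext (Fin.mk.inj h))
      · exact gram_appendCols_zero_of_le_right _ _ hj
    · exact gram_appendCols_zero_of_le_left _ hi _
  loading_sorted := by
    intro i j hij
    change gram (appendCols (θ.Λ kstar) 0) j j ≤ gram (appendCols (θ.Λ kstar) 0) i i
    rcases lt_or_ge j.val r with hj | hj
    · have hi : i.val < r := lt_of_le_of_lt hij hj
      rw [gram_appendCols_zero_of_lt _ hi hi, gram_appendCols_zero_of_lt _ hj hj]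
      exact hθ.loading_sorted _ _ hij
    · rw [gram_appendCols_zero_of_le_left _ hj]
      exact gram_diag_nonneg _ _

theorem Param.Admissible.boundedBy {K N T ℓ : ℕ} {kstar : Fin K} {𝒜 ℱ : Set (Fin ℓ → ℝ)}
    {θ : Param K N T ℓ} (hθ : θ.Admissible kstar 𝒜 ℱ) {B : ℝ} (h𝒜 : ∀ x ∈ 𝒜, ‖x‖ ≤ B)
    (hℱ : ∀ x ∈ ℱ, ‖x‖ ≤ B) : θ.BoundedBy B :=
  ⟨fun k i j => (norm_le_pi_norm (θ.Λ k i) j).trans (h𝒜 _ (hθ.loading_mem k i)),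
    fun t j => (norm_le_pi_norm (θ.F t) j).trans (hℱ _ (hθ.factor_mem t))⟩

theorem loss_sub_nonpos_of_objective_le {K N T ℓ ℓ' : ℕ} (hN : 0 < N) (hT : 0 < T)
    {τ w : Fin K → ℝ} {x : Fin N → Fin T → ℝ} {θ : Param K N T ℓ} {θ' : Param K N T ℓ'}
    (hle : objective τ w x θ ≤ objective τ w x θ') :
    ∑ p : Fin N × Fin T, ∑ k, w k * (check (τ k) (x p.1 p.2 - θ.common k p.1 p.2) -
      check (τ k) (x p.1 p.2 - θ'.common k p.1 p.2)) ≤ 0 := by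
  have h1 := le_of_mul_le_mul_left hle (by positivity)
  rw [Finset.sum_comm]
  simp only [Fintype.sum_prod_type, mul_sub, Finset.sum_sub_distrib]
  linarith

theorem quadratic_form_ge_of_isDiag {ℓ : ℕ} {G : Matrix (Fin ℓ) (Fin ℓ) ℝ} (hG : G.IsDiag) {ν : ℝ}
    (hν : ∀ j, ν ≤ G j j) (v : Fin ℓ → ℝ) : ν * (v ⬝ᵥ v) ≤ v ⬝ᵥ (G *ᵥ v) := by
  rw [dotProduct, dotProduct, Finset.mul_sum]
  refine Finset.sum_le_sum fun j _ => ?_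
  have : (G *ᵥ v) j = G j j * v j := by
    rw [Matrix.mulVec, dotProduct, Finset.sum_eq_single j]
    · intro i _ hij
      rw [hG hij.symm, zero_mul]
    · simp
  rw [this]
  nlinarith [hν j, mul_self_nonneg (v j)]

/-- The rank estimate is exact as soon as the common components are well approximated. -/
theorem rankEstimate_eq_of_close {K N T r s : ℕ} (hN : 0 < N) (hT : 0 < T) {kstar : Fin K}
    {θ : Param K N T s} (hF : gram θ.F = 1) {θ₀ : Param K N T r} (hF₀ : gram θ₀.F = 1)
    (hdiag : (gram (θ₀.Λ kstar)).IsDiag) {κ ν : ℝ} (hκ : 0 ≤ κ)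
    (hν : ∀ j, ν ≤ gram (θ₀.Λ kstar) j j) (hκν : 4 * κ < ν)
    (hD : ∑ p : Fin N × Fin T, ∑ k, (θ.common k p.1 p.2 - θ₀.common k p.1 p.2) ^ 2 ≤
      κ * (N * T)) :
    rankEstimate κ θ = r := by
  have hDk : ∀ k, ∑ i, ∑ t, (θ.common k i t - θ₀.common k i t) ^ 2 ≤ κ * (N * T) := fun k => by
    refine le_trans ?_ hD
    rw [Fintype.sum_prod_type]
    refine Finset.sum_le_sum fun i _ => Finset.sum_le_sum fun t _ => ?_
    exact Finset.single_le_sum (f := fun k => (θ.common k i t - θ₀.common k i t) ^ 2)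
      (fun k _ => sq_nonneg _) (Finset.mem_univ k)
  refine le_antisymm (Finset.sup_le fun k _ => ?_) ?_
  · exact card_gramEigenvalue_le hN hT hF (θ₀.Λ k) θ₀.F (hDk k)
  · refine le_trans ?_ (Finset.le_sup (Finset.mem_univ kstar))
    exact le_card_gramEigenvalue hN hT hF hF₀ hκ (quadratic_form_ge_of_isDiag hdiag hν) hκν
      (hDk kstar)

/-! ### Comparison of rates. -/

theorem rate_eq_sqrt_min (N T : ℕ) : rate N T = Real.sqrt (min N T : ℕ) := by
  rw [rate]
  rcases le_total N T with h | h
  · rw [min_eq_left h, min_eq_left (Real.sqrt_le_sqrt (by exact_mod_cast h))]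
  · rw [min_eq_right h, min_eq_right (Real.sqrt_le_sqrt (by exact_mod_cast h))]

/-- Crude but sufficient: the assumption on `κ * rate` tolerates an entropy factor of order `√m`. -/
theorem log_succ_le_two_mul_sqrt (m : ℕ) : Real.log (m + 1) ≤ 2 * Real.sqrt m := by
  have h0 : (0 : ℝ) ≤ m := Nat.cast_nonneg m
  have h1 := Real.sq_sqrt h0
  have h2 : (m + 1 : ℝ) ≤ (1 + Real.sqrt m) ^ 2 := by nlinarith [Real.sqrt_nonneg (m : ℝ)]
  have h3 : 0 < 1 + Real.sqrt m := by positivity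
  have h4 := Real.log_le_sub_one_of_pos h3
  calc Real.log (m + 1) ≤ Real.log ((1 + Real.sqrt m) ^ 2) :=
        Real.log_le_log (by positivity) h2
    _ = 2 * Real.log (1 + Real.sqrt m) := by rw [Real.log_pow]; norm_num
    _ ≤ 2 * Real.sqrt m := by linarith

/-- The entropy of the grid is dominated by the exponent of the deviation inequality. -/
theorem grid_card_mul_exp_le {K N T s : ℕ} (hN : 0 < N) (hT : 0 < T) {κ b : ℝ} (hb : 0 < b)
    (hκ : 4 * (2 * ((K + 1) * s) + 1) / b ≤ κ * rate N T) :
    ((min N T : ℕ) + 1 : ℝ) ^ (K * (N * s) + T * s) * Real.exp (-(b * (κ / 2 * (N * T)))) ≤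
      Real.exp (-N) := by
  set m := min N T with hm
  set R := Real.sqrt (m : ℝ) with hR
  have hm0 : 0 < m := lt_min hN hT
  have hR1 : 1 ≤ R := by
    rw [hR, Real.one_le_sqrt]
    exact_mod_cast hm0
  have hRR : R * R = m := Real.mul_self_sqrt (Nat.cast_nonneg m)
  rw [rate_eq_sqrt_min, ← hm, ← hR, div_le_iff₀ hb] at hκ
  have hbκ : 0 ≤ κ * R * b := le_trans (by positivity) hκ
  have hκ0 : 0 ≤ κ * b := by
    have : 0 ≤ R * (κ * b) := by linarith
    exact nonneg_of_mul_nonneg_right this (by linarith)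
  have hNT : (m : ℝ) * (N + T) ≤ 2 * (N * T) := by
    have h1 : (m : ℝ) ≤ N := by exact_mod_cast min_le_left N T
    have h2 : (m : ℝ) ≤ T := by exact_mod_cast min_le_right N T
    nlinarith [(Nat.cast_nonneg N : (0 : ℝ) ≤ N), (Nat.cast_nonneg T : (0 : ℝ) ≤ T)]
  have hpow : ((m : ℝ) + 1) ^ (K * (N * s) + T * s) =
      Real.exp ((K * (N * s) + T * s : ℕ) * Real.log (m + 1)) := by
    rw [Real.exp_nat_mul, Real.exp_log (by positivity)]
  rw [hpow, ← Real.exp_add, Real.exp_le_exp]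
  have h1 : ((K * (N * s) + T * s : ℕ) : ℝ) * Real.log (m + 1) ≤
      ((K + 1) * s * (N + T)) * (2 * R) := by
    refine mul_le_mul ?_ (log_succ_le_two_mul_sqrt m) (Real.log_nonneg (by simp)) (by positivity)
    push_cast
    have : (0 : ℝ) ≤ K * T * s + N * s := by positivity
    nlinarith
  have h2 : κ * b * (m * (N + T)) ≤ κ * b * (2 * (N * T)) := mul_le_mul_of_nonneg_left hNT hκ0
  -- In units of `R * (N + T)`, the entropy costs `2 * ((K + 1) * s)` and the target `exp (-N)` at
  -- most `1`. The factor `4` is the `1 / 2` in the exponent times the `1 / 2` lost in `hNT`.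
  have h3 : 4 * (2 * ((K + 1) * s) + 1) * (R * (N + T)) ≤ κ * R * b * (R * (N + T)) :=
    mul_le_mul_of_nonneg_right hκ (by positivity)
  have h4 : κ * R * b * (R * (N + T)) = κ * b * (m * (N + T)) := by rw [← hRR]; ring
  have h5 : (N : ℝ) ≤ R * (N + T) := by
    nlinarith [(Nat.cast_nonneg N : (0 : ℝ) ≤ N), (Nat.cast_nonneg T : (0 : ℝ) ≤ T)]
  nlinarith

/-- Shows that a grid of mesh of order `1 / min N T` is fine enough relative to `κ`. -/
theorem div_min_le_of_le_mul_rate {N T : ℕ} (hN : 0 < N) (hT : 0 < T) {C κ : ℝ} (hC : 0 ≤ C)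
    (h : C ≤ κ * rate N T) : C / (min N T : ℕ) ≤ κ := by
  have hm0 : 0 < min N T := lt_min hN hT
  have hm : (0 : ℝ) < (min N T : ℕ) := by exact_mod_cast hm0
  rw [rate_eq_sqrt_min] at h
  set R := Real.sqrt (min N T : ℕ) with hR
  have hR1 : 1 ≤ R := by
    rw [hR, Real.one_le_sqrt]
    exact_mod_cast hm0
  have hRR : R * R = (min N T : ℕ) := Real.mul_self_sqrt hm.le
  rw [div_le_iff₀ hm, ← hRR]
  nlinarith

theorem exists_pos_lt_of_forall_pos {ι : Type*} [Finite ι] {ν : ι → ℝ} (hν : ∀ j, 0 < ν j) :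
    ∃ ν₀ > 0, ∀ j, ν₀ < ν j := by
  rcases isEmpty_or_nonempty ι with h | h
  -- This case is needed for `r = 0`.
  · exact ⟨1, one_pos, fun j => h.elim j⟩
  · obtain ⟨j₀, hj₀⟩ := Finite.exists_min ν
    exact ⟨ν j₀ / 2, half_pos (hν j₀), fun j => (half_lt_self (hν j₀)).trans_le (hj₀ j)⟩

/-! ### Assembly. -/

/-- The probability that the rank estimate is wrong is eventually at most `exp (-N)`. -/
theorem eventually_prob_rankEstimate_ne_le {Ω : Type*} [MeasurableSpace Ω] (P : Measure Ω)
    [IsProbabilityMeasure P] {K r s : ℕ} (hrs : r < s)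
    (τ w : Fin K → ℝ) (hτ : ∀ k, 0 < τ k ∧ τ k < 1) (hw : ∀ k, 0 < w k) (kstar : Fin K)
    (𝒜r ℱr : Set (Fin r → ℝ)) (𝒜s ℱs : Set (Fin s → ℝ))
    (h𝒜s : IsCompact 𝒜s) (hℱs : IsCompact ℱs)
    (θ₀ : ∀ N T : ℕ, Param K N T r)
    (X : ∀ N T : ℕ, Fin N → Fin T → Ω → ℝ)
    (h : ∀ N T : ℕ, Fin N → Fin T → ℝ → ℝ)
    (hmodel : QuantileFactorModel P τ θ₀ X)
    (hcons : ConsistencyAssumptions P kstar 𝒜r ℱr θ₀ X h)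
    (hnum : FactorNumberAssumptions 𝒜s ℱs θ₀ h)
    (θhat : ∀ N T : ℕ, Ω → Param K N T s)
    (hθhat : ∀ᶠ p : ℕ × ℕ in atTop ×ˢ atTop, ∀ᵐ ω ∂P,
      IsEstimate τ w kstar 𝒜s ℱs (fun i t => X p.1 p.2 i t ω) (θhat p.1 p.2 ω))
    (κ : ℕ → ℕ → ℝ)
    (hκ : Tendsto (fun p : ℕ × ℕ => κ p.1 p.2) (atTop ×ˢ atTop) (𝓝 0))
    (hκL : Tendsto (fun p : ℕ × ℕ => κ p.1 p.2 * rate p.1 p.2) (atTop ×ˢ atTop) atTop) :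
    ∀ᶠ p : ℕ × ℕ in atTop ×ˢ atTop,
      P {ω | rankEstimate (κ p.1 p.2) (θhat p.1 p.2 ω) ≠ r} ≤
        ENNReal.ofReal (Real.exp (-p.1)) := by
  have : Nonempty (Fin K) := ⟨kstar⟩
  obtain ⟨w₀, hw₀, hw₀w⟩ := exists_pos_lt_of_forall_pos hw
  obtain ⟨B₁, hB₁, h𝒜B₁⟩ := h𝒜s.isBounded.exists_pos_norm_le
  obtain ⟨B₂, hB₂, hℱB₂⟩ := hℱs.isBounded.exists_pos_norm_le
  set B := max B₁ B₂
  have hB : 0 < B := lt_max_of_lt_left hB₁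
  have h𝒜B : ∀ x ∈ 𝒜s, ‖x‖ ≤ B := fun x hx => (h𝒜B₁ x hx).trans (le_max_left _ _)
  have hℱB : ∀ x ∈ ℱs, ‖x‖ ≤ B := fun x hx => (hℱB₂ x hx).trans (le_max_right _ _)
  obtain ⟨a, ha, hah⟩ := hcons.density_lower (Set.Icc (-(s * B ^ 2)) (s * B ^ 2)) isCompact_Icc
  obtain ⟨ν, -, hνpos, hνlim⟩ := hcons.eigenvalue_limits
  obtain ⟨ν₀, hν₀, hν₀ν⟩ := exists_pos_lt_of_forall_pos hνpos
  set W := ∑ k, w k ^ 2 with hW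
  have hWpos : 0 < W := Finset.sum_pos (fun k _ => pow_pos (hw k) 2) Finset.univ_nonempty
  have hwsum : 0 ≤ ∑ k, w k := Finset.sum_nonneg fun k _ => (hw k).le
  set b := (w₀ * a / 8) ^ 2 / (2 * W) with hb
  have hbpos : 0 < b := by positivity
  -- `C₁` and `C₂` turn the two rounding conditions of `prob_exists_far_le`, with `m = min N T` and
  -- `η = κ`, into `C / m ≤ κ`.
  set C₁ : ℝ := 2 * (K * (s * (4 * B ^ 2) * (4 * (s * B ^ 2)))) with hC₁
  have hC₁0 : 0 ≤ C₁ := by positivity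
  set C₂ : ℝ := 2 * ((∑ k, w k) * (s * (4 * B ^ 2))) / (w₀ * a / 8) with hC₂
  have hC₂0 : 0 ≤ C₂ := by positivity
  have hN : ∀ᶠ p : ℕ × ℕ in atTop ×ˢ atTop, 0 < p.1 :=
    tendsto_fst.eventually (eventually_gt_atTop 0)
  have hT : ∀ᶠ p : ℕ × ℕ in atTop ×ˢ atTop, 0 < p.2 :=
    tendsto_snd.eventually (eventually_gt_atTop 0)
  have hν : ∀ᶠ p : ℕ × ℕ in atTop ×ˢ atTop, ∀ j, ν₀ < gram ((θ₀ p.1 p.2).Λ kstar) j j :=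
    eventually_all.2 fun j => (hνlim j).eventually (lt_mem_nhds (hν₀ν j))
  have hκν : ∀ᶠ p : ℕ × ℕ in atTop ×ˢ atTop, κ p.1 p.2 < ν₀ / 4 :=
    hκ.eventually (gt_mem_nhds (by positivity))
  filter_upwards [hN, hT, hν, hκν, hcons.admissible, hnum.augmented_mem, hθhat,
    hκL.eventually_ge_atTop (4 * (2 * ((K + 1) * s) + 1) / b), hκL.eventually_ge_atTop C₁,
    hκL.eventually_ge_atTop C₂] with p hN hT hν hκν hadm hVex hest hκb hκ₁ hκ₂
  obtain ⟨N, T⟩ := p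
  simp only at *
  obtain ⟨V, hV₁, hV₂, hV₃⟩ := hVex
  have hκ0 : 0 ≤ κ N T := (by positivity : (0 : ℝ) ≤ C₁ / (min N T : ℕ)).trans
    (div_min_le_of_le_mul_rate hN hT hC₁0 hκ₁)
  have haug := hadm.augment hV₁ hV₂ hV₃
  have hcommon : ∀ k i t, ((θ₀ N T).augment V).common k i t = (θ₀ N T).common k i t :=
    (θ₀ N T).augment_common hrs.le V
  -- Passing through the augmented parameter lets one radius `B`, taken from the `s`-dimensional
  -- sets, bound estimate and truth alike.
  have hqB : ∀ k (p : Fin N × Fin T), |(θ₀ N T).common k p.1 p.2| ≤ s * B ^ 2 := fun k p => by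
    rw [← hcommon]
    exact (haug.boundedBy h𝒜B hℱB).abs_common_le k p.1 p.2
  -- The errors at a single level suffice: they differ from the data by constants.
  have hind : iIndepFun (fun (p : Fin N × Fin T) => X N T p.1 p.2) P := by
    have h1 := (hcons.errors_indep N T kstar).comp
      (fun p y => y + (θ₀ N T).common kstar p.1 p.2) fun p => measurable_id.add_const _
    refine h1.congr fun p => Eventually.of_forall fun ω => ?_
    simp
  have hη₁ : K * (s * (4 * B ^ 2 / (min N T : ℕ)) * (4 * (s * B ^ 2))) ≤ κ N T / 2 := by
    have h1 := div_min_le_of_le_mul_rate hN hT hC₁0 hκ₁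
    have h2 : K * (s * (4 * B ^ 2 / (min N T : ℕ)) * (4 * (s * B ^ 2))) =
        C₁ / (min N T : ℕ) / 2 := by rw [hC₁]; ring
    rw [h2]
    linarith
  have hη₂ : (∑ k, w k) * (s * (4 * B ^ 2 / (min N T : ℕ))) ≤ w₀ * a / 8 * (κ N T / 2) := by
    have h1 := div_min_le_of_le_mul_rate hN hT hC₂0 hκ₂
    have h2 : (∑ k, w k) * (s * (4 * B ^ 2 / (min N T : ℕ))) =
        w₀ * a / 8 * (C₂ / (min N T : ℕ) / 2) := by rw [hC₂]; field_simp
    rw [h2]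
    gcongr
  have hfar := prob_exists_far_le (P := P) (s := s) (lt_min hN hT)
    (Y := fun p : Fin N × Fin T => X N T p.1 p.2) (fun p => hmodel.measurable N T p.1 p.2) hind
    (fun p => hcons.density N T p.1 p.2) hτ hw₀ (fun k => (hw₀w k).le) le_rfl ha hB
    (fun k p => hmodel.quantile_eq N T k p.1 p.2) hqB (fun p => hah N T p.1 p.2) hη₁ hη₂
  refine le_trans (measure_mono_ae ?_) (hfar.trans (ENNReal.ofReal_le_ofReal
    (grid_card_mul_exp_le hN hT hbpos hκb)))
  filter_upwards [hest] with ω hω hne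
  refine ⟨θhat N T ω, hω.1.boundedBy h𝒜B hℱB, ?_, ?_⟩
  · have h1 := loss_sub_nonpos_of_objective_le hN hT (hω.2 _ haug)
    simp only [hcommon] at h1
    exact h1
  · by_contra! hclose
    exact hne (rankEstimate_eq_of_close hN hT hω.1.factor_normalized hadm.factor_normalized
      hadm.loading_diag hκ0 (fun j => (hν j).le) (by linarith) hclose)

end DAFM

end

theorem theorem4 {Ω : Type*} [MeasurableSpace Ω] (P : Measure Ω) [IsProbabilityMeasure P]
    {K r s : ℕ} (hrs : r < s)
    (τ w : Fin K → ℝ) (hτ : ∀ k, 0 < τ k ∧ τ k < 1) (hw : ∀ k, 0 < w k) (kstar : Fin K)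
    (𝒜r ℱr : Set (Fin r → ℝ)) (𝒜s ℱs : Set (Fin s → ℝ))
    (h𝒜s : IsCompact 𝒜s) (hℱs : IsCompact ℱs)
    (θ₀ : ∀ N T : ℕ, DAFM.Param K N T r)
    (X : ∀ N T : ℕ, Fin N → Fin T → Ω → ℝ)
    (h : ∀ N T : ℕ, Fin N → Fin T → ℝ → ℝ)
    (hmodel : DAFM.QuantileFactorModel P τ θ₀ X)
    (hcons : DAFM.ConsistencyAssumptions P kstar 𝒜r ℱr θ₀ X h)
    (hnum : DAFM.FactorNumberAssumptions 𝒜s ℱs θ₀ h)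
    (θhat : ∀ N T : ℕ, Ω → DAFM.Param K N T s)
    (hθhat : ∀ᶠ p : ℕ × ℕ in atTop ×ˢ atTop, ∀ᵐ ω ∂P,
      DAFM.IsEstimate τ w kstar 𝒜s ℱs (fun i t => X p.1 p.2 i t ω) (θhat p.1 p.2 ω))
    (κ : ℕ → ℕ → ℝ)
    (hκ : Tendsto (fun p : ℕ × ℕ => κ p.1 p.2) (atTop ×ˢ atTop) (𝓝 0))
    (hκL : Tendsto (fun p : ℕ × ℕ => κ p.1 p.2 * DAFM.rate p.1 p.2) (atTop ×ˢ atTop) atTop) :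
    Tendsto (fun p : ℕ × ℕ => P {ω | DAFM.rankEstimate (κ p.1 p.2) (θhat p.1 p.2 ω) = r})
        (atTop ×ˢ atTop) (𝓝 1) ∧
      Tendsto (fun p : ℕ × ℕ => P {ω | DAFM.rankEstimate (κ p.1 p.2) (θhat p.1 p.2 ω) ≠ r})
        (atTop ×ˢ atTop) (𝓝 0) := by

  have hzero : Tendsto
      (fun p : ℕ × ℕ => P {ω | DAFM.rankEstimate (κ p.1 p.2) (θhat p.1 p.2 ω) ≠ r})
      (atTop ×ˢ atTop) (𝓝 0) := by
    have hexp : Tendsto (fun p : ℕ × ℕ => ENNReal.ofReal (Real.exp (-p.1)))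
        (atTop ×ˢ atTop) (𝓝 0) := by
      rw [← ENNReal.ofReal_zero]
      exact ENNReal.tendsto_ofReal (Real.tendsto_exp_neg_atTop_nhds_zero.comp
        (tendsto_natCast_atTop_atTop.comp tendsto_fst))
    exact tendsto_of_tendsto_of_tendsto_of_le_of_le' tendsto_const_nhds hexp
      (Eventually.of_forall fun _ => zero_le)
      (DAFM.eventually_prob_rankEstimate_ne_le P hrs τ w hτ hw kstar 𝒜r ℱr 𝒜s ℱs h𝒜s hℱs θ₀ X h
        hmodel hcons hnum θhat hθhat κ hκ hκL)
  refine ⟨?_, hzero⟩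
  have hone : Tendsto (fun p : ℕ × ℕ =>
      1 - P {ω | DAFM.rankEstimate (κ p.1 p.2) (θhat p.1 p.2 ω) ≠ r})
      (atTop ×ˢ atTop) (𝓝 1) := by
    simpa using ENNReal.Tendsto.sub tendsto_const_nhds hzero (Or.inl ENNReal.one_ne_top)
  refine tendsto_of_tendsto_of_tendsto_of_le_of_le hone tendsto_const_nhds (fun p => ?_)
    fun p => prob_le_one
  -- Subadditivity of the outer measure gives `1 ≤ P(A) + P(Aᶜ)` without measurability of `A`.
  rw [tsub_le_iff_right, ← measure_univ (μ := P)]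
  refine le_trans (measure_mono fun ω _ => ?_) (measure_union_le _ _)
  exact em _
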